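/- Let $d\ge 1$, let $G$ be a measure on $(0,+\infty)$ whose tail function $\bar G(u)=G((u,+\infty))$ is finite for every $u>0$, let $h:\mathbb R^d\to[0,+\infty]$ be measurable, and let $\Phi$ be a Poisson point process on $\mathbb R^d\times(0,+\infty)$ with intensity $dx\,G(dm)$, defined on a probability space and viewed as a random locally finite set. The extremal shot noise $M$ is the random field $$M(y)=\sup\{m\,h(y-x)\;;\;(x,m)\in\Phi\}\in[0,+\infty],\qquad y\in\mathbb R^d .$$ For measurable $f:\mathbb R^d\to[0,+\infty]$ put $$\alpha(f,G)=\inf\Big\{u>0\;;\;\int_{\mathbb R^d}\bar G\big(u/f(x)\big)\,dx<+\infty\Big\},$$ with $\inf\emptyset=+\infty$, where $\bar G(u/f(x))=0$ if $f(x)=0$ and $\bar G(u/f(x))=G((0,+\infty))$ if $f(x)=+\infty$. Let $\alpha^+(h,G)=\alpha(h^+,G)$ with $h^+(x)=\sup\{h(x+z);|z|\le 1\}$, and $\alpha^-(h,G)=\lim_{\varepsilon\to0^+}\alpha(h^-_\varepsilon,G)$ with $h^-_\varepsilon(x)=\inf\{h(x+z);|z|\le\varepsilon\}$. Then: 1.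 If $h$ is lower semicontinuous, then $M$ is lower semicontinuous (for every realization of $\Phi$). 2. If $\alpha^-(h,G)=\alpha^+(h,G)$ and $h$ is upper semicontinuous, then $M$ is almost surely upper semicontinuous. 3. If $\alpha^-(h,G)=\alpha^+(h,G)$ and $h$ is continuous, then $M$ is almost surely continuous (as a $[0,+\infty]$-valued function). -/

import Mathlib

open MeasureTheory ProbabilityTheory Filter Topology
open scoped ENNReal

noncomputable section

/-- `Φ` is a Poisson point process on `E` with intensity measure `μ`, defined on `(Ω, P)`: a random
locally finite subset of `E` whose counts on Borel sets are random variables with values in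
`ℕ ∪ {∞}`, are Poisson distributed with parameter `μ A` when `μ A < ∞`, and are independent on
disjoint sets. -/
structure IsPoissonPointProcess {Ω E : Type*} [MeasurableSpace Ω] [TopologicalSpace E]
    [MeasurableSpace E] (P : Measure Ω) (μ : Measure E) (Φ : Ω → Set E) : Prop where
  finite_inter_compact : ∀ ω, ∀ K : Set E, IsCompact K → (Φ ω ∩ K).Finite
  measurable_count : ∀ A : Set E, MeasurableSet A → Measurable fun ω => (Φ ω ∩ A).encard
  poisson_count : ∀ A : Set E, MeasurableSet A → μ A < ∞ →
    HasLaw (fun ω => (Φ ω ∩ A).encard)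
      ((poissonMeasure (μ A).toNNReal).map (Nat.cast : ℕ → ℕ∞)) P
  indep_count : ∀ (n : ℕ) (A : Fin n → Set E), (∀ i, MeasurableSet (A i)) →
    Pairwise (fun i j => Disjoint (A i) (A j)) →
    iIndepFun (fun i ω => (Φ ω ∩ A i).encard) P

/-- The tail function `u ↦ G((u, ∞))` on `[0, ∞]` of a measure `G` on `(0, ∞)`. -/
def tailFun (G : Measure (Set.Ioi (0 : ℝ))) (u : ℝ≥0∞) : ℝ≥0∞ :=
  G {m | u < ENNReal.ofReal (m : ℝ)}

/-- The coefficient `α(h, G) = inf {u > 0 : ∫ Ḡ(u / h(x)) dx < ∞}`, with `inf ∅ = ∞`. For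
`0 < u < ∞` the division of `[0, ∞]` gives `u / 0 = ∞`, with tail `0`, and `u / ∞ = 0`, with tail
`G((0, ∞))`. -/
def alphaCoeff {d : ℕ} (h : EuclideanSpace ℝ (Fin d) → ℝ≥0∞)
    (G : Measure (Set.Ioi (0 : ℝ))) : ℝ≥0∞ :=
  sInf {u : ℝ≥0∞ | 0 < u ∧ u < ∞ ∧ ∫⁻ x, tailFun G (u / h x) < ∞}

/-- `h⁺(x) = sup {h(x + z) : |z| ≤ 1}`. -/
def upperEnv {d : ℕ} (h : EuclideanSpace ℝ (Fin d) → ℝ≥0∞) (x : EuclideanSpace ℝ (Fin d)) :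
    ℝ≥0∞ :=
  ⨆ z : EuclideanSpace ℝ (Fin d), ⨆ _ : ‖z‖ ≤ 1, h (x + z)

/-- `h⁻_ε(x) = inf {h(x + z) : |z| ≤ ε}`. -/
def lowerEnv {d : ℕ} (ε : ℝ) (h : EuclideanSpace ℝ (Fin d) → ℝ≥0∞)
    (x : EuclideanSpace ℝ (Fin d)) : ℝ≥0∞ :=
  ⨅ z : EuclideanSpace ℝ (Fin d), ⨅ _ : ‖z‖ ≤ ε, h (x + z)

/-- `α⁺(h, G) = α(h⁺, G)`. -/
def alphaPlus {d : ℕ} (h : EuclideanSpace ℝ (Fin d) → ℝ≥0∞)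
    (G : Measure (Set.Ioi (0 : ℝ))) : ℝ≥0∞ :=
  alphaCoeff (upperEnv h) G

/-- `α⁻(h, G) = lim_{ε → 0, ε > 0} α(h⁻_ε, G)`; the limit exists, see `tendsto_alphaMinus`. -/
def alphaMinus {d : ℕ} (h : EuclideanSpace ℝ (Fin d) → ℝ≥0∞)
    (G : Measure (Set.Ioi (0 : ℝ))) : ℝ≥0∞ :=
  limUnder (𝓝[>] (0 : ℝ)) fun ε => alphaCoeff (lowerEnv ε h) G

theorem alphaCoeff_mono {d : ℕ} {h h' : EuclideanSpace ℝ (Fin d) → ℝ≥0∞} (hle : h ≤ h')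
    (G : Measure (Set.Ioi (0 : ℝ))) : alphaCoeff h G ≤ alphaCoeff h' G := by
  refine sInf_le_sInf ?_
  rintro u ⟨h0, h1, h2⟩
  refine ⟨h0, h1, lt_of_le_of_lt (lintegral_mono fun x => measure_mono ?_) h2⟩
  intro m hm
  exact lt_of_le_of_lt (ENNReal.div_le_div_left (hle x) u) hm

theorem tendsto_alphaMinus {d : ℕ} (h : EuclideanSpace ℝ (Fin d) → ℝ≥0∞)
    (G : Measure (Set.Ioi (0 : ℝ))) :
    Tendsto (fun ε => alphaCoeff (lowerEnv ε h) G) (𝓝[>] (0 : ℝ)) (𝓝 (alphaMinus h G)) := by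
  have hanti : Antitone fun ε : ℝ => alphaCoeff (lowerEnv ε h) G := by
    intro ε ε' hε
    refine alphaCoeff_mono (fun x => ?_) G
    exact iInf_mono fun z => le_iInf fun hz => iInf_le_of_le (hz.trans hε) le_rfl
  exact tendsto_nhds_limUnder ⟨_, hanti.tendsto_nhdsGT 0⟩

/-- The extremal shot noise `M(y) = sup {m h(y - x) : (x, m) ∈ Φ}` of a set `Φ` of points of
`ℝ^d × (0, ∞)`, with values in `[0, ∞]`. -/
def extremalShotNoise {d : ℕ} (h : EuclideanSpace ℝ (Fin d) → ℝ≥0∞)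
    (Φ : Set (EuclideanSpace ℝ (Fin d) × Set.Ioi (0 : ℝ))) (y : EuclideanSpace ℝ (Fin d)) :
    ℝ≥0∞ :=
  ⨆ φ ∈ Φ, ENNReal.ofReal (φ.2 : ℝ) * h (y - φ.1)

end

/-!
Almost surely `M ≥ α⁻(h, G)` everywhere: for `0 < u < α(h⁻_ε, G)` the points with
`m h⁻_ε(y - x) > u` form a set of infinite intensity, so almost surely one exists for every `y` in
a countable dense set, and `h⁻_ε ≤ h(· + z)` for `|z| ≤ ε` carries the bound over to all `y`. Above
`α⁺(h, G)` the exceedances are locally finite: for `u > α(h⁺, G)` almost surely only finitely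
many points satisfy `m h⁺(y - x) > u`, and no other point exceeds `u` anywhere in the unit ball
around `y`. When `α⁻ = α⁺`, for every `u > M(y)` the field `max u M` is therefore, near `y`, a
finite maximum of upper semicontinuous functions.
-/

namespace IsPoissonPointProcess

variable {Ω E : Type*} [MeasurableSpace Ω] [TopologicalSpace E] [MeasurableSpace E]
  {P : Measure Ω} {μ : Measure E} {Φ : Ω → Set E} {A : Set E}

theorem ae_finite_inter (hΦ : IsPoissonPointProcess P μ Φ) (hA : MeasurableSet A) (hμ : μ A < ∞) :
    ∀ᵐ ω ∂P, (Φ ω ∩ A).Finite := by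
  have hlaw := (hΦ.poisson_count A hA hμ).ae_iff (p := (· ≠ ⊤)) .of_discrete
  simp only [Set.encard_ne_top_iff] at hlaw
  rw [hlaw, ae_map_iff Measurable.of_discrete.aemeasurable .of_discrete]
  exact .of_forall ENat.natCast_ne_top

theorem measure_inter_eq_empty (hΦ : IsPoissonPointProcess P μ Φ) (hA : MeasurableSet A)
    (hμ : μ A < ∞) : P {ω | Φ ω ∩ A = ∅} = ENNReal.ofReal (Real.exp (-(μ A).toReal)) := by
  have hlaw := (hΦ.poisson_count A hA hμ).measure_eq (p := (· = 0)) .of_discrete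
  have hzero : (Nat.cast : ℕ → ℕ∞) ⁻¹' {n | n = 0} = {0} := by ext; simp
  rw [Measure.map_apply .of_discrete .of_discrete, hzero, poissonMeasure_singleton] at hlaw
  simpa [Set.encard_eq_zero, ENNReal.coe_toNNReal_eq_toReal] using hlaw

theorem ae_nonempty_inter [SigmaFinite μ] (hΦ : IsPoissonPointProcess P μ Φ)
    (hA : MeasurableSet A) (hμ : μ A = ∞) : ∀ᵐ ω ∂P, (Φ ω ∩ A).Nonempty := by
  have void_le (n : ℕ) : P {ω | ¬(Φ ω ∩ A).Nonempty} ≤ ENNReal.ofReal (Real.exp (-n)) := by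
    obtain ⟨B, hB, hBA, hnB, hBfin⟩ :=
      Measure.exists_subset_measure_lt_top hA (hμ ▸ ENNReal.natCast_lt_top n)
    have hn : (n : ℝ) ≤ (μ B).toReal := by simpa using ENNReal.toReal_mono hBfin.ne hnB.le
    calc P {ω | ¬(Φ ω ∩ A).Nonempty}
      _ ≤ P {ω | Φ ω ∩ B = ∅} := measure_mono fun ω hω =>
          Set.subset_eq_empty (Set.inter_subset_inter_right _ hBA)
            (Set.not_nonempty_iff_eq_empty.1 hω)
      _ = ENNReal.ofReal (Real.exp (-(μ B).toReal)) := hΦ.measure_inter_eq_empty hB hBfin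
      _ ≤ ENNReal.ofReal (Real.exp (-n)) := by gcongr
  have hlim : Tendsto (fun n : ℕ => ENNReal.ofReal (Real.exp (-n))) atTop (𝓝 0) := by
    simpa using ENNReal.tendsto_ofReal
      (Real.tendsto_exp_neg_atTop_nhds_zero.comp tendsto_natCast_atTop_atTop)
  exact ae_iff.2 (nonpos_iff_eq_zero.1 (ge_of_tendsto' hlim void_le))

end IsPoissonPointProcess

section Semicontinuity

variable {X Y ι α : Type*} [TopologicalSpace X] [TopologicalSpace Y] [CompleteLinearOrder α]

theorem upperSemicontinuous_biSup_of_isCompact {f : X → Y → α}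
    (hf : UpperSemicontinuous fun p : X × Y => f p.1 p.2) {K : Set Y} (hK : IsCompact K) :
    UpperSemicontinuous fun x => ⨆ y ∈ K, f x y := by
  intro x c hc
  have hlt : ∀ᶠ x' in 𝓝 x, ∀ y ∈ K, f x' y < c :=
    hK.eventually_forall_of_forall_eventually fun y hy =>
      hf (x, y) c ((le_biSup (f x) hy).trans_lt hc)
  filter_upwards [hlt] with x' hx'
  obtain rfl | hne := K.eq_empty_or_nonempty
  · simpa using bot_le.trans_lt hc
  · have hslice : UpperSemicontinuousOn (f x') K :=
      (hf.comp (Continuous.prodMk_right x')).upperSemicontinuousOn K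
    obtain ⟨y, hy, hmax⟩ := hslice.exists_isMaxOn hne hK
    have hle : ⨆ z ∈ K, f x' z ≤ f x' y := iSup₂_le fun _ hz => hmax hz
    exact hle.trans_lt (hx' y hy)

theorem upperSemicontinuous_iSup_of_locallyFinite [DenselyOrdered α] {f : ι → X → α} {a : α}
    (hf : ∀ i, UpperSemicontinuous (f i)) (ha : ∀ x, a ≤ ⨆ i, f i x)
    (hfin : ∀ u, a < u → LocallyFinite fun i => {x | u < f i x}) :
    UpperSemicontinuous fun x => ⨆ i, f i x := by
  intro x c hc
  obtain ⟨u, hu, huc⟩ := exists_between hc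
  obtain ⟨t, ht, hF⟩ := hfin u ((ha x).trans_lt hu) x
  have hlt : ∀ᶠ y in 𝓝 x, ∀ i ∈ {i | ({x | u < f i x} ∩ t).Nonempty}, f i y < u :=
    (eventually_all_finite hF).2 fun i _ => hf i x u ((le_iSup (f · x) i).trans_lt hu)
  filter_upwards [ht, hlt] with y hyt hy
  refine (iSup_le fun i => ?_).trans_lt huc
  by_contra! hi
  exact (hy i ⟨y, hi, hyt⟩).not_gt hi

end Semicontinuity

section Envelopes

variable {d : ℕ} {h : EuclideanSpace ℝ (Fin d) → ℝ≥0∞} {ε : ℝ} {x y : EuclideanSpace ℝ (Fin d)}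

theorem le_upperEnv (h : EuclideanSpace ℝ (Fin d) → ℝ≥0∞) (hxy : dist x y ≤ 1) :
    h x ≤ upperEnv h y :=
  calc h x
    _ = h (y + (x - y)) := by rw [add_sub_cancel]
    _ ≤ upperEnv h y :=
      le_iSup₂ (f := fun z (_ : ‖z‖ ≤ 1) => h (y + z)) (x - y) (by rwa [← dist_eq_norm])

theorem lowerEnv_le (h : EuclideanSpace ℝ (Fin d) → ℝ≥0∞) (hxy : dist x y ≤ ε) :
    lowerEnv ε h y ≤ h x :=
  calc lowerEnv ε h y
    _ ≤ h (y + (x - y)) := iInf₂_le (x - y) (by rwa [← dist_eq_norm])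
    _ = h x := by rw [add_sub_cancel]

theorem upperSemicontinuous_upperEnv (hh : UpperSemicontinuous h) :
    UpperSemicontinuous (upperEnv h) := by
  unfold upperEnv
  simpa only [mem_closedBall_zero_iff] using
    upperSemicontinuous_biSup_of_isCompact (hh.comp continuous_add)
      (isCompact_closedBall (0 : EuclideanSpace ℝ (Fin d)) 1)

theorem upperSemicontinuous_lowerEnv (hh : UpperSemicontinuous h) (ε : ℝ) :
    UpperSemicontinuous (lowerEnv ε h) :=
  upperSemicontinuous_biInf fun z _ => hh.comp (continuous_add_const z)

end Envelopes

section ExtremalShotNoise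

/-- The set of points `(x, m)` whose contribution `m f(y - x)` to the extremal shot noise at `y`
exceeds the level `u`. -/
def exceedanceSet {d : ℕ} (f : EuclideanSpace ℝ (Fin d) → ℝ≥0∞) (u : ℝ≥0∞)
    (y : EuclideanSpace ℝ (Fin d)) : Set (EuclideanSpace ℝ (Fin d) × Set.Ioi (0 : ℝ)) :=
  {φ | u < ENNReal.ofReal (φ.2 : ℝ) * f (y - φ.1)}

variable {d : ℕ} {f h : EuclideanSpace ℝ (Fin d) → ℝ≥0∞} {G : Measure (Set.Ioi (0 : ℝ))}

theorem lt_extremalShotNoise_iff {Φ : Set (EuclideanSpace ℝ (Fin d) × Set.Ioi (0 : ℝ))}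
    {u : ℝ≥0∞} {y : EuclideanSpace ℝ (Fin d)} :
    u < extremalShotNoise f Φ y ↔ (Φ ∩ exceedanceSet f u y).Nonempty :=
  lt_biSup_iff

theorem exceedanceSet_antitone (f : EuclideanSpace ℝ (Fin d) → ℝ≥0∞)
    (y : EuclideanSpace ℝ (Fin d)) : Antitone fun u => exceedanceSet f u y :=
  fun _ _ huv _ hφ => huv.trans_lt hφ

theorem exceedanceSet_subset_exceedanceSet_upperEnv (h : EuclideanSpace ℝ (Fin d) → ℝ≥0∞)
    (u : ℝ≥0∞) {x y : EuclideanSpace ℝ (Fin d)} (hxy : dist x y ≤ 1) :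
    exceedanceSet h u x ⊆ exceedanceSet (upperEnv h) u y := fun φ hφ =>
  lt_of_lt_of_le hφ (mul_le_mul_right (le_upperEnv h (by rwa [dist_sub_right])) _)

theorem extremalShotNoise_lowerEnv_le (h : EuclideanSpace ℝ (Fin d) → ℝ≥0∞)
    (Φ : Set (EuclideanSpace ℝ (Fin d) × Set.Ioi (0 : ℝ))) {ε : ℝ}
    {x y : EuclideanSpace ℝ (Fin d)} (hxy : dist x y ≤ ε) :
    extremalShotNoise (lowerEnv ε h) Φ y ≤ extremalShotNoise h Φ x :=
  iSup₂_mono fun _ _ => mul_le_mul_right (lowerEnv_le h (by rwa [dist_sub_right])) _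

theorem measurableSet_exceedanceSet (hf : Measurable f) (u : ℝ≥0∞)
    (y : EuclideanSpace ℝ (Fin d)) : MeasurableSet (exceedanceSet f u y) :=
  measurableSet_lt measurable_const (by fun_prop)

theorem prod_exceedanceSet [SFinite G] (hf : Measurable f) {u : ℝ≥0∞} (hu₀ : u ≠ 0)
    (hu : u ≠ ∞) (y : EuclideanSpace ℝ (Fin d)) :
    ((volume : Measure (EuclideanSpace ℝ (Fin d))).prod G) (exceedanceSet f u y) =
      ∫⁻ x, tailFun G (u / f x) := by
  rw [Measure.prod_apply (measurableSet_exceedanceSet hf u y),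
    ← lintegral_sub_left_eq_self (fun x => tailFun G (u / f x)) y]
  refine lintegral_congr fun x => congrArg G (Set.ext fun m => ?_)
  exact (ENNReal.div_lt_iff (.inr hu₀) (.inr hu)).symm

theorem prod_exceedanceSet_lt_top [SFinite G] (hf : Measurable f) {u : ℝ≥0∞}
    (hu : alphaCoeff f G < u) (y : EuclideanSpace ℝ (Fin d)) :
    ((volume : Measure (EuclideanSpace ℝ (Fin d))).prod G) (exceedanceSet f u y) < ∞ := by
  obtain ⟨v, ⟨hv₀, hv, hfin⟩, hvu⟩ := sInf_lt_iff.1 hu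
  rw [← prod_exceedanceSet hf hv₀.ne' hv.ne y] at hfin
  exact (measure_mono (exceedanceSet_antitone f y hvu.le)).trans_lt hfin

theorem prod_exceedanceSet_eq_top [SFinite G] (hf : Measurable f) {u : ℝ≥0∞} (hu₀ : 0 < u)
    (hu : u < alphaCoeff f G) (y : EuclideanSpace ℝ (Fin d)) :
    ((volume : Measure (EuclideanSpace ℝ (Fin d))).prod G) (exceedanceSet f u y) = ∞ := by
  rw [prod_exceedanceSet hf hu₀.ne' hu.ne_top]
  by_contra hne
  exact notMem_of_lt_csInf' hu ⟨hu₀, hu.lt_top, lt_top_iff_ne_top.2 hne⟩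

theorem lowerSemicontinuous_extremalShotNoise (hh : LowerSemicontinuous h)
    (Φ : Set (EuclideanSpace ℝ (Fin d) × Set.Ioi (0 : ℝ))) :
    LowerSemicontinuous (extremalShotNoise h Φ) :=
  lowerSemicontinuous_biSup fun φ _ =>
    (ENNReal.continuous_const_mul ENNReal.ofReal_ne_top).comp_lowerSemicontinuous
      (hh.comp (continuous_sub_right φ.1)) mul_right_mono

theorem upperSemicontinuous_extremalShotNoise {a : ℝ≥0∞}
    {Φ : Set (EuclideanSpace ℝ (Fin d) × Set.Ioi (0 : ℝ))} (hh : UpperSemicontinuous h)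
    (ha : ∀ y, a ≤ extremalShotNoise h Φ y)
    (hfin : ∀ u, a < u → LocallyFinite fun φ : Φ => {y | ↑φ ∈ exceedanceSet h u y}) :
    UpperSemicontinuous (extremalShotNoise h Φ) := by
  unfold extremalShotNoise at ha ⊢
  simp only [iSup_subtype'] at ha ⊢
  refine upperSemicontinuous_iSup_of_locallyFinite (fun φ => ?_) ha hfin
  exact (ENNReal.continuous_const_mul ENNReal.ofReal_ne_top).comp_upperSemicontinuous
    (hh.comp (continuous_sub_right φ.1.1)) mul_right_mono

end ExtremalShotNoise

section Poisson

variable {Ω : Type*} [MeasurableSpace Ω] {P : Measure Ω} {d : ℕ} {G : Measure (Set.Ioi (0 : ℝ))}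
  [SigmaFinite G] {Φ : Ω → Set (EuclideanSpace ℝ (Fin d) × Set.Ioi (0 : ℝ))}
  {f h : EuclideanSpace ℝ (Fin d) → ℝ≥0∞}

theorem ae_alphaCoeff_le_extremalShotNoise
    (hΦ : IsPoissonPointProcess P ((volume : Measure (EuclideanSpace ℝ (Fin d))).prod G) Φ)
    (hf : Measurable f) (y : EuclideanSpace ℝ (Fin d)) :
    ∀ᵐ ω ∂P, alphaCoeff f G ≤ extremalShotNoise f (Φ ω) y := by
  obtain ⟨D, hDc, hD⟩ := TopologicalSpace.exists_countable_dense ℝ≥0∞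
  have hhit : ∀ u ∈ D, ∀ᵐ ω ∂P, 0 < u → u < alphaCoeff f G →
      (Φ ω ∩ exceedanceSet f u y).Nonempty := fun u _ =>
    ae_all_iff.2 fun hu₀ => ae_all_iff.2 fun hu =>
      hΦ.ae_nonempty_inter (measurableSet_exceedanceSet hf u y)
        (prod_exceedanceSet_eq_top hf hu₀ hu y)
  filter_upwards [(ae_ball_iff hDc).2 hhit] with ω hω
  by_contra! hlt
  obtain ⟨u, huD, hMu, hu⟩ := hD.exists_between hlt
  exact hMu.not_gt (lt_extremalShotNoise_iff.2 (hω u huD (pos_of_gt hMu) hu))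

theorem ae_alphaMinus_le_extremalShotNoise
    (hΦ : IsPoissonPointProcess P ((volume : Measure (EuclideanSpace ℝ (Fin d))).prod G) Φ)
    (hh : UpperSemicontinuous h) :
    ∀ᵐ ω ∂P, ∀ y, alphaMinus h G ≤ extremalShotNoise h (Φ ω) y := by
  obtain ⟨S, hSc, hS⟩ := TopologicalSpace.exists_countable_dense (EuclideanSpace ℝ (Fin d))
  obtain ⟨ε, -, hεpos, hε⟩ := exists_seq_strictAnti_tendsto (0 : ℝ)
  have hlow : ∀ᵐ ω ∂P, ∀ n, ∀ s ∈ S,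
      alphaCoeff (lowerEnv (ε n) h) G ≤ extremalShotNoise (lowerEnv (ε n) h) (Φ ω) s :=
    ae_all_iff.2 fun n => (ae_ball_iff hSc).2 fun s _ =>
      ae_alphaCoeff_le_extremalShotNoise hΦ (upperSemicontinuous_lowerEnv hh (ε n)).measurable s
  have hlim : Tendsto (fun n => alphaCoeff (lowerEnv (ε n) h) G) atTop (𝓝 (alphaMinus h G)) :=
    (tendsto_alphaMinus h G).comp (tendsto_nhdsWithin_iff.2 ⟨hε, .of_forall hεpos⟩)
  filter_upwards [hlow] with ω hω y
  refine le_of_tendsto' hlim fun n => ?_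
  obtain ⟨s, hsS, hs⟩ := hS.exists_dist_lt y (hεpos n)
  exact (hω n s hsS).trans (extremalShotNoise_lowerEnv_le h (Φ ω) hs.le)

theorem ae_finite_inter_exceedanceSet
    (hΦ : IsPoissonPointProcess P ((volume : Measure (EuclideanSpace ℝ (Fin d))).prod G) Φ)
    (hf : Measurable f) (y : EuclideanSpace ℝ (Fin d)) :
    ∀ᵐ ω ∂P, ∀ u, alphaCoeff f G < u → (Φ ω ∩ exceedanceSet f u y).Finite := by
  obtain ⟨D, hDc, hD⟩ := TopologicalSpace.exists_countable_dense ℝ≥0∞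
  have hfin : ∀ v ∈ D, ∀ᵐ ω ∂P, alphaCoeff f G < v → (Φ ω ∩ exceedanceSet f v y).Finite :=
    fun v _ => ae_all_iff.2 fun hv =>
      hΦ.ae_finite_inter (measurableSet_exceedanceSet hf v y) (prod_exceedanceSet_lt_top hf hv y)
  filter_upwards [(ae_ball_iff hDc).2 hfin] with ω hω u hu
  obtain ⟨v, hvD, hv, hvu⟩ := hD.exists_between hu
  exact (hω v hvD hv).subset (Set.inter_subset_inter_right _ (exceedanceSet_antitone f y hvu.le))

theorem ae_locallyFinite_exceedance
    (hΦ : IsPoissonPointProcess P ((volume : Measure (EuclideanSpace ℝ (Fin d))).prod G) Φ)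
    (hh : UpperSemicontinuous h) :
    ∀ᵐ ω ∂P, ∀ u, alphaPlus h G < u →
      LocallyFinite fun φ : Φ ω => {y | ↑φ ∈ exceedanceSet h u y} := by
  obtain ⟨S, hSc, hS⟩ := TopologicalSpace.exists_countable_dense (EuclideanSpace ℝ (Fin d))
  have hfin := (ae_ball_iff hSc).2 fun s _ =>
    ae_finite_inter_exceedanceSet hΦ (upperSemicontinuous_upperEnv hh).measurable s
  filter_upwards [hfin] with ω hω u hu y
  obtain ⟨s, hsS, hs⟩ := hS.exists_dist_lt y one_pos
  refine ⟨Metric.ball s 1, Metric.isOpen_ball.mem_nhds hs, ?_⟩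
  refine ((hω s hsS u hu).preimage Subtype.val_injective.injOn).subset ?_
  rintro φ ⟨y', hy', hy's⟩
  exact ⟨φ.2, exceedanceSet_subset_exceedanceSet_upperEnv h u (Metric.mem_ball.1 hy's).le hy'⟩

theorem ae_upperSemicontinuous_extremalShotNoise
    (hΦ : IsPoissonPointProcess P ((volume : Measure (EuclideanSpace ℝ (Fin d))).prod G) Φ)
    (hα : alphaMinus h G = alphaPlus h G) (hh : UpperSemicontinuous h) :
    ∀ᵐ ω ∂P, UpperSemicontinuous (extremalShotNoise h (Φ ω)) := by
  filter_upwards [ae_alphaMinus_le_extremalShotNoise hΦ hh, ae_locallyFinite_exceedance hΦ hh]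
    with ω hlow hfin
  exact upperSemicontinuous_extremalShotNoise hh hlow (hα ▸ hfin)

end Poisson

theorem sigmaFinite_of_tail_lt_top {G : Measure (Set.Ioi (0 : ℝ))}
    (hG : ∀ u : ℝ, 0 < u → G {m | u < (m : ℝ)} < ∞) : SigmaFinite G := by
  refine ⟨⟨⟨fun n => {m | 1 / ((n : ℝ) + 1) < (m : ℝ)}, fun _ => trivial,
    fun n => hG _ (by positivity), Set.eq_univ_of_forall fun m => Set.mem_iUnion.2 ?_⟩⟩⟩
  exact exists_nat_one_div_lt (Set.mem_Ioi.1 m.2)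

theorem proposition2p6_general {Ω : Type*} [MeasurableSpace Ω] {P : Measure Ω} {d : ℕ}
    {G : Measure (Set.Ioi (0 : ℝ))} [SigmaFinite G]
    {Φ : Ω → Set (EuclideanSpace ℝ (Fin d) × Set.Ioi (0 : ℝ))}
    (hΦ : IsPoissonPointProcess P ((volume : Measure (EuclideanSpace ℝ (Fin d))).prod G) Φ)
    (h : EuclideanSpace ℝ (Fin d) → ℝ≥0∞) :
    (LowerSemicontinuous h → ∀ ω, LowerSemicontinuous (extremalShotNoise h (Φ ω))) ∧
    (alphaMinus h G = alphaPlus h G → UpperSemicontinuous h →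
      ∀ᵐ ω ∂P, UpperSemicontinuous (extremalShotNoise h (Φ ω))) ∧
    (alphaMinus h G = alphaPlus h G → Continuous h →
      ∀ᵐ ω ∂P, Continuous (extremalShotNoise h (Φ ω))) := by
  refine ⟨fun hl ω => lowerSemicontinuous_extremalShotNoise hl (Φ ω),
    ae_upperSemicontinuous_extremalShotNoise hΦ, fun hα hc => ?_⟩
  filter_upwards [ae_upperSemicontinuous_extremalShotNoise hΦ hα hc.upperSemicontinuous] with ω hω
  exact continuous_iff_lower_upperSemicontinuous.2
    ⟨lowerSemicontinuous_extremalShotNoise hc.lowerSemicontinuous (Φ ω), hω⟩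

theorem proposition2p6 {Ω : Type*} [MeasurableSpace Ω] (P : Measure Ω) [IsProbabilityMeasure P]
    {d : ℕ} (G : Measure (Set.Ioi (0 : ℝ)))
    (hG : ∀ u : ℝ, 0 < u → G {m | u < (m : ℝ)} < ∞)
    (Φ : Ω → Set (EuclideanSpace ℝ (Fin d) × Set.Ioi (0 : ℝ)))
    (hΦ : IsPoissonPointProcess P ((volume : Measure (EuclideanSpace ℝ (Fin d))).prod G) Φ)
    (h : EuclideanSpace ℝ (Fin d) → ℝ≥0∞) (hh : Measurable h) :
    (LowerSemicontinuous h → ∀ ω, LowerSemicontinuous (extremalShotNoise h (Φ ω))) ∧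
    (alphaMinus h G = alphaPlus h G → UpperSemicontinuous h →
      ∀ᵐ ω ∂P, UpperSemicontinuous (extremalShotNoise h (Φ ω))) ∧
    (alphaMinus h G = alphaPlus h G → Continuous h →
      ∀ᵐ ω ∂P, Continuous (extremalShotNoise h (Φ ω))) := by
  have := sigmaFinite_of_tail_lt_top hG
  exact proposition2p6_general hΦ h
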